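/- Let $n \ge k > 1$ be integers and let $\mathcal G$ be a loopless directed graph on $n+1$ nodes, a dealer $D$ and participants $1,\dots,n$ (an undirected edge counts as two opposite directed edges). An edge $u\to v$ is a private link over which $u$ can send data to $v$. Let $\mathcal N(D)$ be the set of participants with an incoming edge from $D$, and let $\deg(i)$ be the number of incoming edges at participant $i$. The dealer holds a secret $S$, a random variable with values in a finite alphabet and with Shannon entropy $H(S)>0$, and random values independent of $S$. A protocol runs for finitely many rounds; in each round every node sends a letter of a finite alphabet over each of its outgoing links. The letters sent by the dealer are functions of $S$, of its random values and of the letters it received in earlier rounds; the letters sent by a participant are functions of the letters it received in earlier rounds. The protocol performs $(n,k)$ secret sharing on $\mathcal G$ if (i) ($k$-secret-recovery) the data received by any $k$ participants determine $S$ almost surely, and (ii) ($(k-1)$-collusion-resistance) the data jointly received by any at most $k-1$ participants are independent of $S$. For an edge $e$ let $X_e$ be the sequence of all letters sent over $e$. The total communication of the protocol, with the size of the secret as the unit of data, is $\Gamma=\sum_{e} H(X_e)/H(S)$, the sum being over all edges of $\mathcal G$. Then for every protocol that performs $(n,k)$ secret sharing on $\mathcal G$, every participant $i\notin\mathcal N(D)$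 has $\deg(i)\ge k$ (so the fractions below have positive denominators), and $$\Gamma \;\ge\; |\mathcal N(D)| + \sum_{i\notin \mathcal N(D)} \frac{\deg(i)}{\deg(i)-k+1} \;\ge\; n ,$$ where the sum is over the participants outside $\mathcal N(D)$. -/

import Mathlib

open MeasureTheory ProbabilityTheory

namespace SecretSharing

/-- The `n + 1` nodes of the network: `none` is the dealer, `some i` is participant `i`. -/
abbrev Node (n : ℕ) := Option (Fin n)

/-- The nodes with a link into `v`. An edge `G.Adj u v` is a one-way link from `u` to `v`;
an undirected edge is a pair of opposite directed edges. -/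
abbrev InNbr {n : ℕ} (G : Digraph (Node n)) (v : Node n) := {u : Node n // G.Adj u v}

/-- The nodes to which `v` has a link. -/
abbrev OutNbr {n : ℕ} (G : Digraph (Node n)) (v : Node n) := {u : Node n // G.Adj v u}

open Classical in
/-- The number of incoming edges at a node. -/
noncomputable def inDegree {n : ℕ} (G : Digraph (Node n)) (v : Node n) : ℕ :=
  (Finset.univ.filter fun u : Node n => G.Adj u v).card

open Classical in
/-- The participants that have an incoming edge directly from the dealer. -/
noncomputable def dealerNbrs {n : ℕ} (G : Digraph (Node n)) : Finset (Fin n) :=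
  Finset.univ.filter fun i : Fin n => G.Adj none (some i)

/-- What node `v` has received in the rounds `0, …, t - 1`: one letter of the message alphabet `M`
per round and per incoming link. -/
abbrev History {n : ℕ} (G : Digraph (Node n)) (M : Type*) (t : ℕ) (v : Node n) :=
  Fin t → InNbr G v → M

/-- A protocol on the network `G`, with secrets in `A`, random values of the dealer in `Ω` and
messages in `M`. In every round every node sends one letter over each of its outgoing links (silence
may be one of the letters). What the dealer sends depends on the secret, on its random values and on
what it received in earlier rounds; what a participant sends is a function of what it received in
earlier rounds. The functions may depend on `G`. -/
structure Protocol {n : ℕ} (G : Digraph (Node n)) (A Ω M : Type*)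
    [MeasurableSpace Ω] [MeasurableSpace M] where
  rounds : ℕ
  dealerSend : (t : ℕ) → A → Ω → History G M t none → OutNbr G none → M
  measurable_dealerSend : ∀ (t : ℕ) (s : A) (h : History G M t none) (v : OutNbr G none),
    Measurable fun ω : Ω => dealerSend t s ω h v
  nodeSend : (i : Fin n) → (t : ℕ) → History G M t (some i) → OutNbr G (some i) → M

/-- Shannon entropy (in nats) of a random variable with finitely many values. -/
noncomputable def entropy {Ω X : Type*} [MeasurableSpace Ω] [Fintype X] (μ : Measure Ω)
    (f : Ω → X) : ℝ :=
  ∑ x : X, Real.negMulLog (μ.real (f ⁻¹' {x}))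

namespace Protocol

variable {n : ℕ} {G : Digraph (Node n)} {A Ω M : Type*} [MeasurableSpace Ω] [MeasurableSpace M]

/-- The letter sent in round `t` over the link from `u` to `v` when the protocol is executed
with secret `x.1` and random values `x.2`. -/
def sent (P : Protocol G A Ω M) (x : A × Ω) : (t : ℕ) → (u v : Node n) → G.Adj u v → M
  | t, none, v, h =>
      P.dealerSend t x.1 x.2 (fun r w => P.sent x r.1 w.1 none w.2) ⟨v, h⟩
  | t, some i, v, h =>
      P.nodeSend i t (fun r w => P.sent x r.1 w.1 (some i) w.2) ⟨v, h⟩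
termination_by t => t
decreasing_by
  all_goals exact r.2

/-- All the data passed over the link from `u` to `v` during the execution. -/
def linkData (P : Protocol G A Ω M) (u v : Node n) (h : G.Adj u v) (x : A × Ω) :
    Fin P.rounds → M :=
  fun t => P.sent x t.1 u v h

/-- All the data available at participant `i` at the end of the execution. -/
def view (P : Protocol G A Ω M) (i : Fin n) (x : A × Ω) : History G M P.rounds (some i) :=
  fun t u => P.sent x t.1 u.1 (some i) u.2

/-- The data jointly available at the participants in `K`. -/
def jointView (P : Protocol G A Ω M) (K : Finset (Fin n)) (x : A × Ω) :
    (i : K) → History G M P.rounds (some i.1) :=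
  fun i => P.view i.1 x

/-- `P` performs `(n, k)` secret sharing when the secret has law `law` and the dealer's random
values are drawn, independently of the secret, from `coins`. A share is a function of the data
available at its participant, so recovery is only required from those data. -/
structure IsSecretSharing [MeasurableSpace A] (P : Protocol G A Ω M)
    (law : Measure A) (coins : Measure Ω) (k : ℕ) : Prop where
  /-- `k`-secret-recovery: any `k` participants can compute the secret. -/
  recovery : ∀ K : Finset (Fin n), K.card = k →
    ∃ decode : ((i : K) → History G M P.rounds (some i.1)) → A,
      ∀ᵐ x ∂(law.prod coins), decode (P.jointView K x) = x.1
  /-- `(k-1)`-collusion-resistance: the data gathered by fewer than `k` participants are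
  independent of the secret. -/
  secrecy : ∀ K : Finset (Fin n), K.card < k →
    IndepFun (fun x : A × Ω => x.1) (P.jointView K) (law.prod coins)

open Classical in
/-- The amount of data (as entropy) downloaded by node `v`, summed over its incoming links. -/
noncomputable def download [MeasurableSpace A] [Fintype M] (P : Protocol G A Ω M)
    (law : Measure A) (coins : Measure Ω) (v : Node n) : ℝ :=
  ∑ u : InNbr G v, entropy (law.prod coins) (P.linkData u.1 v u.2)

/-- The total communication of the protocol, over all links of the network, where one unit of
data is the size (entropy) of the secret. -/
noncomputable def totalCommunication [Fintype A] [MeasurableSpace A] [Fintype M]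
    (P : Protocol G A Ω M) (law : Measure A) (coins : Measure Ω) : ℝ :=
  (∑ v : Node n, P.download law coins v) / entropy law (id : A → A)

end Protocol

end SecretSharing

/-! Fix a participant `i` and a set `T` of its incoming links such that fewer than `k` links lie
outside `T`, none of them from the dealer. The senders of these other links fit in a set `K` of `k -
1` participants not containing `i`. The view of `K` is independent of the secret. Participants have
no randomness, so this view determines all that `K` sends; together with the data on `T` it gives
the view of `i`, hence the secret, as `K ∪ {i}` has `k` members. So the data on `T` have at least
the entropy of the secret (`entropy_le_sum_linkData`). If the dealer has no link to `i`, every `T`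
of size `deg - k + 1` qualifies, and averaging over them (`card_mul_le_mul_sum_of_card_eq`) gives
the fraction. For the dealer's neighbours, `T` is the set of all incoming links. -/

namespace SecretSharing

/-! ### Shannon entropy of finite-valued random variables -/

section Entropy

variable {Ω X Y Z : Type*} [MeasurableSpace Ω] {μ : Measure Ω}

theorem measureReal_preimage_le_comp [IsProbabilityMeasure μ] (f : Ω → X) (g : X → Y) (x : X) :
    μ.real (f ⁻¹' {x}) ≤ μ.real ((fun ω => g (f ω)) ⁻¹' {g x}) :=
  measureReal_mono fun ω hω => by
    simp only [Set.mem_preimage, Set.mem_singleton_iff] at hω ⊢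
    rw [hω]

variable [Fintype X]

theorem entropy_nonneg [IsProbabilityMeasure μ] (f : Ω → X) : 0 ≤ entropy μ f :=
  Finset.sum_nonneg fun _ _ => Real.negMulLog_nonneg measureReal_nonneg measureReal_le_one

theorem entropy_congr_ae {f g : Ω → X} (h : f =ᵐ[μ] g) : entropy μ f = entropy μ g := by
  refine Finset.sum_congr rfl fun x _ => ?_
  congr 1
  refine measureReal_congr ?_
  filter_upwards [h] with ω hω
  exact congrArg (· = x) hω

theorem measureReal_preimage_comp [IsProbabilityMeasure μ] [MeasurableSpace X]
    [MeasurableSingletonClass X] [DecidableEq Y] {f : Ω → X} (hf : Measurable f) (g : X → Y)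
    (y : Y) :
    μ.real ((fun ω => g (f ω)) ⁻¹' {y}) =
      ∑ x ∈ Finset.univ.filter (fun x => g x = y), μ.real (f ⁻¹' {x}) := by
  rw [sum_measureReal_preimage_singleton _ fun x _ => hf (measurableSet_singleton x)]
  congr 1
  ext ω
  simp

theorem sum_measureReal_preimage_eq_one [IsProbabilityMeasure μ] [MeasurableSpace X]
    [MeasurableSingletonClass X] {f : Ω → X} (hf : Measurable f) :
    ∑ x, μ.real (f ⁻¹' {x}) = 1 := by
  rw [sum_measureReal_preimage_singleton _ fun x _ => hf (measurableSet_singleton x)]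
  simp

variable [Fintype Y] [Fintype Z]

/-- The law of `g ∘ f` is the image under `g` of the law of `f`. -/
theorem sum_measureReal_mul_comp [IsProbabilityMeasure μ] [MeasurableSpace X]
    [MeasurableSingletonClass X] {f : Ω → X} (hf : Measurable f) (g : X → Y) (c : Y → ℝ) :
    ∑ x, μ.real (f ⁻¹' {x}) * c (g x) = ∑ y, μ.real ((fun ω => g (f ω)) ⁻¹' {y}) * c y := by
  classical
  rw [← Finset.sum_fiberwise Finset.univ g]
  refine Finset.sum_congr rfl fun y _ => ?_
  rw [measureReal_preimage_comp hf, Finset.sum_mul]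
  refine Finset.sum_congr rfl fun x hx => ?_
  rw [(Finset.mem_filter.1 hx).2]

/-- A function of a random variable has at most its entropy. -/
theorem entropy_comp_le [IsProbabilityMeasure μ] [MeasurableSpace X]
    [MeasurableSingletonClass X] {f : Ω → X} (hf : Measurable f) (g : X → Y) :
    entropy μ (fun ω => g (f ω)) ≤ entropy μ f := by
  have h := sum_measureReal_mul_comp (μ := μ) hf g
    fun y => -Real.log (μ.real ((fun ω => g (f ω)) ⁻¹' {y}))
  have e : entropy μ (fun ω => g (f ω)) = ∑ y, μ.real ((fun ω => g (f ω)) ⁻¹' {y}) *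
      -Real.log (μ.real ((fun ω => g (f ω)) ⁻¹' {y})) :=
    Finset.sum_congr rfl fun y _ => by rw [Real.negMulLog]; ring
  rw [e, ← h]
  refine Finset.sum_le_sum fun x _ => ?_
  rw [Real.negMulLog, neg_mul, mul_neg, neg_le_neg_iff]
  rcases (measureReal_nonneg (μ := μ) (s := f ⁻¹' {x})).eq_or_lt with h0 | h0
  · simp [← h0]
  · exact mul_le_mul_of_nonneg_left
      (Real.log_le_log h0 (measureReal_preimage_le_comp f g x)) h0.le

/-- Gibbs' inequality. -/
theorem sum_negMulLog_le_of_sum_le {p q : X → ℝ} (hp : ∀ x, 0 ≤ p x) (hq : ∀ x, 0 ≤ q x)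
    (hpq : ∀ x, q x = 0 → p x = 0) (hsum : ∑ x, q x ≤ ∑ x, p x) :
    ∑ x, Real.negMulLog (p x) ≤ ∑ x, p x * -Real.log (q x) := by
  -- This is `log t ≤ t - 1` at `t = q x / p x`; the corrections `q x - p x` sum to at most zero.
  have key : ∀ x, Real.negMulLog (p x) ≤ p x * -Real.log (q x) + (q x - p x) := by
    intro x
    rcases (hp x).eq_or_lt with h0 | h0
    · simp [← h0, hq x]
    have hq0 : 0 < q x := (hq x).lt_of_ne fun h => h0.ne' (hpq x h.symm)
    have h1 := Real.log_le_sub_one_of_pos (div_pos hq0 h0)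
    rw [Real.log_div hq0.ne' h0.ne'] at h1
    have h2 := mul_le_mul_of_nonneg_left h1 h0.le
    have h3 : p x * (q x / p x - 1) = q x - p x := by field_simp
    rw [Real.negMulLog]
    linarith
  have := Finset.sum_le_sum fun x (_ : x ∈ Finset.univ) => key x
  rw [Finset.sum_add_distrib, Finset.sum_sub_distrib] at this
  linarith

/-- Gibbs' inequality with `p` the joint law and `q` the product of the marginals: the logarithm of
the product splits the right-hand side into the two entropies. -/
theorem entropy_prodMk_le [IsProbabilityMeasure μ] [MeasurableSpace X]
    [MeasurableSingletonClass X] [MeasurableSpace Y] [MeasurableSingletonClass Y]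
    {f : Ω → X} {g : Ω → Y} (hf : Measurable f) (hg : Measurable g) :
    entropy μ (fun ω => (f ω, g ω)) ≤ entropy μ f + entropy μ g := by
  have hfg : Measurable fun ω => (f ω, g ω) := hf.prodMk hg
  have h1 := sum_measureReal_mul_comp (μ := μ) hfg Prod.fst
    fun x => -Real.log (μ.real (f ⁻¹' {x}))
  have h2 := sum_measureReal_mul_comp (μ := μ) hfg Prod.snd
    fun y => -Real.log (μ.real (g ⁻¹' {y}))
  have l1 : ∀ z : X × Y, μ.real ((fun ω => (f ω, g ω)) ⁻¹' {z}) ≤ μ.real (f ⁻¹' {z.1}) :=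
    measureReal_preimage_le_comp (fun ω => (f ω, g ω)) Prod.fst
  have l2 : ∀ z : X × Y, μ.real ((fun ω => (f ω, g ω)) ⁻¹' {z}) ≤ μ.real (g ⁻¹' {z.2}) :=
    measureReal_preimage_le_comp (fun ω => (f ω, g ω)) Prod.snd
  have h := sum_negMulLog_le_of_sum_le (X := X × Y)
    (p := fun z => μ.real ((fun ω => (f ω, g ω)) ⁻¹' {z}))
    (q := fun z => μ.real (f ⁻¹' {z.1}) * μ.real (g ⁻¹' {z.2}))
    (fun _ => measureReal_nonneg) (fun _ => mul_nonneg measureReal_nonneg measureReal_nonneg)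
    (fun z hz => by
      refine le_antisymm ?_ measureReal_nonneg
      rcases mul_eq_zero.1 hz with h0 | h0
      · exact h0 ▸ l1 z
      · exact h0 ▸ l2 z)
    (by
      rw [sum_measureReal_preimage_eq_one hfg, Fintype.sum_prod_type]
      simp only [← Finset.mul_sum]
      rw [sum_measureReal_preimage_eq_one hg]
      simp [sum_measureReal_preimage_eq_one hf])
  refine h.trans (le_of_eq ?_)
  have e : ∀ z : X × Y, μ.real ((fun ω => (f ω, g ω)) ⁻¹' {z}) *
      -Real.log (μ.real (f ⁻¹' {z.1}) * μ.real (g ⁻¹' {z.2})) =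
      μ.real ((fun ω => (f ω, g ω)) ⁻¹' {z}) * -Real.log (μ.real (f ⁻¹' {z.1})) +
      μ.real ((fun ω => (f ω, g ω)) ⁻¹' {z}) * -Real.log (μ.real (g ⁻¹' {z.2})) := by
    intro z
    rcases (measureReal_nonneg (μ := μ) (s := (fun ω => (f ω, g ω)) ⁻¹' {z})).eq_or_lt
      with h0 | h0
    · simp [← h0]
    · rw [Real.log_mul (h0.trans_le (l1 z)).ne' (h0.trans_le (l2 z)).ne']
      ring
  rw [Finset.sum_congr rfl fun z _ => e z, Finset.sum_add_distrib, h1, h2]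
  simp only [entropy, Real.negMulLog, neg_mul, mul_neg]

theorem entropy_prodMk_of_indepFun [IsProbabilityMeasure μ] [MeasurableSpace X]
    [MeasurableSingletonClass X] [MeasurableSpace Y] [MeasurableSingletonClass Y]
    {f : Ω → X} {g : Ω → Y} (hf : Measurable f) (hg : Measurable g) (h : IndepFun f g μ) :
    entropy μ (fun ω => (f ω, g ω)) = entropy μ f + entropy μ g := by
  have e : ∀ x y, μ.real ((fun ω => (f ω, g ω)) ⁻¹' {(x, y)}) =
      μ.real (f ⁻¹' {x}) * μ.real (g ⁻¹' {y}) := by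
    intro x y
    have := h.measure_inter_preimage_eq_mul {x} {y} (measurableSet_singleton x)
      (measurableSet_singleton y)
    rw [Measure.real, Measure.real, Measure.real, ← ENNReal.toReal_mul, ← this]
    congr 2
    ext ω
    simp
  simp only [entropy, Fintype.sum_prod_type, e, Real.negMulLog_mul, Finset.sum_add_distrib,
    ← Finset.sum_mul, ← Finset.mul_sum, sum_measureReal_preimage_eq_one hf,
    sum_measureReal_preimage_eq_one hg, one_mul]

/-- Data that complete `g`, independent of `f`, to a description of `f` have at least the
entropy of `f`. -/
theorem entropy_le_of_indepFun_of_determined [IsProbabilityMeasure μ] [MeasurableSpace X]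
    [MeasurableSingletonClass X] [MeasurableSpace Y] [MeasurableSingletonClass Y]
    [MeasurableSpace Z] [MeasurableSingletonClass Z]
    {f : Ω → X} {g : Ω → Y} {w : Ω → Z} (hf : Measurable f) (hg : Measurable g)
    (hw : Measurable w) (h : IndepFun f g μ) (F : Z × Y → X)
    (hF : ∀ᵐ ω ∂μ, F (w ω, g ω) = f ω) :
    entropy μ f ≤ entropy μ w := by
  -- The chain is `H(f) + H(g) = H(f, g) ≤ H(w, g) ≤ H(w) + H(g)`, from which `H(g)` cancels.
  have h1 : entropy μ (fun ω => (f ω, g ω)) ≤ entropy μ (fun ω => (w ω, g ω)) := by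
    have : (fun ω => (f ω, g ω)) =ᵐ[μ] fun ω => (F (w ω, g ω), g ω) := by
      filter_upwards [hF] with ω hω
      rw [hω]
    rw [entropy_congr_ae this]
    exact entropy_comp_le (hw.prodMk hg) fun z => (F z, z.2)
  have h2 := entropy_prodMk_le (μ := μ) hw hg
  rw [entropy_prodMk_of_indepFun hf hg h] at h1
  linarith

/-- Subadditivity of entropy for a finite family. -/
theorem entropy_restrict_le_sum [IsProbabilityMeasure μ] [MeasurableSpace X]
    [MeasurableSingletonClass X] {ι : Type*} [DecidableEq ι] (f : ι → Ω → X)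
    (hf : ∀ i, Measurable (f i)) (T : Finset ι) :
    entropy μ (fun ω (i : T) => f i ω) ≤ ∑ i ∈ T, entropy μ (f i) := by
  induction T using Finset.induction_on with
  | empty =>
    simp only [Finset.sum_empty]
    rw [entropy, Fintype.sum_unique]
    have : (fun ω (i : (∅ : Finset ι)) => f i ω) ⁻¹' {default} = Set.univ := by
      ext ω
      simp [eq_iff_true_of_subsingleton]
    simp [this]
  | insert a T ha ih =>
    rw [Finset.sum_insert ha]
    have hT : Measurable fun ω (i : T) => f i ω := measurable_pi_lambda _ fun i => hf i
    refine le_trans ?_ ((entropy_prodMk_le (μ := μ) (hf a) hT).trans (by gcongr))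
    have := entropy_comp_le (μ := μ) ((hf a).prodMk hT)
      (fun z (i : (insert a T : Finset ι)) =>
        if h : i.1 ∈ T then z.2 ⟨i.1, h⟩ else z.1)
    refine le_trans (le_of_eq ?_) this
    congr 1
    funext ω i
    by_cases h : i.1 ∈ T
    · simp [h]
    · have : i.1 = a := (Finset.mem_insert.1 i.2).resolve_right h
      simp [ha, this]

end Entropy

/-! ### Averaging over subsets -/

/-- If every `m`-subset has sum at least `H`, then the average over a larger set shows that its
sum is at least proportionally larger. -/
theorem card_mul_le_mul_sum_of_card_eq {ι : Type*} [DecidableEq ι] {h : ι → ℝ} {H : ℝ} {m : ℕ}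
    (hm : 0 < m) (hH : ∀ T : Finset ι, T.card = m → H ≤ ∑ u ∈ T, h u) :
    ∀ j, m ≤ j → ∀ T : Finset ι, T.card = j → (j : ℝ) * H ≤ m * ∑ u ∈ T, h u := by
  intro j hj
  induction j, hj using Nat.le_induction with
  | base => exact fun T hT => mul_le_mul_of_nonneg_left (hH T hT) (Nat.cast_nonneg m)
  | succ j hj ih =>
    intro T hT
    -- The induction hypothesis is summed over all deletions of one element. Each `h v` survives `j`
    -- of the `j + 1` deletions, so a factor `j` cancels at the end.
    have h1 : ∑ u ∈ T, (j : ℝ) * H ≤ ∑ u ∈ T, m * (∑ v ∈ T, h v - h u) := by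
      refine Finset.sum_le_sum fun u hu => ?_
      have := ih (T.erase u) (by rw [Finset.card_erase_of_mem hu, hT]; rfl)
      rwa [Finset.sum_erase_eq_sub hu] at this
    rw [← Finset.mul_sum _ _ (m : ℝ), Finset.sum_sub_distrib, Finset.sum_const, Finset.sum_const, hT,
      nsmul_eq_mul, nsmul_eq_mul] at h1
    have hj0 : (0 : ℝ) < j := by exact_mod_cast hm.trans_le hj
    push_cast at h1 ⊢
    refine le_of_mul_le_mul_left ?_ hj0
    linarith

/-! ### Views, link data and the entropy bound at one participant -/

namespace Protocol

variable {n : ℕ} {G : Digraph (Node n)} {A Ω M : Type*} [MeasurableSpace Ω] [MeasurableSpace M]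

theorem linkData_eq_of_view_eq (P : Protocol G A Ω M) {i : Fin n} {v : Node n}
    (h : G.Adj (some i) v) {x y : A × Ω} (hxy : P.view i x = P.view i y) :
    P.linkData (some i) v h x = P.linkData (some i) v h y := by
  funext t
  simp only [linkData]
  rw [sent, sent]
  congr 1
  funext r w
  exact congrFun (congrFun hxy ⟨r.1, r.2.trans t.2⟩) w

theorem measurable_sent [Fintype A] [MeasurableSpace A] [MeasurableSingletonClass A] [Fintype M]
    [MeasurableSingletonClass M] (P : Protocol G A Ω M) (t : ℕ) (u v : Node n) (h : G.Adj u v) :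
    Measurable fun x => P.sent x t u v h := by
  classical
  induction t using Nat.strong_induction_on generalizing u v with
  | _ t ih =>
    have hist : ∀ w : Node n, Measurable fun x : A × Ω =>
        (fun r v => P.sent x r.1 v.1 w v.2 : History G M t w) := fun w =>
      measurable_pi_lambda _ fun r => measurable_pi_lambda _ fun v => ih r.1 r.2 _ _ _
    cases u with
    | none =>
      -- The secret and the history range over a finite set, so measurability in the random values
      -- for each fixed pair suffices.
      have hd : Measurable fun y : (A × History G M t none) × Ω =>
          P.dealerSend t y.1.1 y.2 y.1.2 ⟨v, h⟩ :=
        measurable_from_prod_countable_right fun y => P.measurable_dealerSend t y.1 y.2 ⟨v, h⟩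
      have := hd.comp ((measurable_fst.prodMk (hist none)).prodMk measurable_snd)
      convert this using 1
      funext x
      rw [sent]
      rfl
    | some i =>
      have hn : Measurable fun y : History G M t (some i) => P.nodeSend i t y ⟨v, h⟩ :=
        measurable_of_finite _
      convert hn.comp (hist (some i)) using 1
      funext x
      rw [sent]
      rfl

variable [Fintype A] [MeasurableSpace A] [MeasurableSingletonClass A] [Fintype M]
  [MeasurableSingletonClass M]

theorem measurable_linkData (P : Protocol G A Ω M) (u v : Node n) (h : G.Adj u v) :
    Measurable (P.linkData u v h) :=
  measurable_pi_lambda _ fun t => P.measurable_sent t.1 u v h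

theorem measurable_jointView (P : Protocol G A Ω M) (K : Finset (Fin n)) :
    Measurable (P.jointView K) :=
  measurable_pi_lambda _ fun i => measurable_pi_lambda _ fun t => measurable_pi_lambda _ fun u =>
    P.measurable_sent t.1 u.1 (some i.1) u.2

open Classical in
/-- The links into a participant, after removal of those from fewer than `k` participants, carry at
least the entropy of the secret. -/
theorem IsSecretSharing.entropy_le_sum_linkData {P : Protocol G A Ω M} {law : Measure A}
    {coins : Measure Ω} [IsProbabilityMeasure law] [IsProbabilityMeasure coins] {k : ℕ}
    (hP : P.IsSecretSharing law coins k) (hk : 0 < k) (hkn : k ≤ n)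
    (i : Fin n) (hG : ¬ G.Adj (some i) (some i))
    (T : Finset (InNbr G (some i))) (hT : Tᶜ.card < k) (hD : ∀ u ∉ T, u.1 ≠ none) :
    entropy law (id : A → A) ≤
      ∑ u ∈ T, entropy (law.prod coins) (P.linkData u.1 (some i) u.2) := by
  -- `K` consists of the senders outside `T`, padded to exactly `k - 1` participants. Looplessness
  -- keeps `i` out of the senders, and `k ≤ n` leaves room for the padding.
  obtain ⟨K, hTK, hKi, hKc⟩ : ∃ K : Finset (Fin n),
      Finset.eraseNone (Tᶜ.image Subtype.val) ⊆ K ∧ K ⊆ Finset.univ.erase i ∧ K.card = k - 1 := by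
    refine Finset.exists_subsuperset_card_eq ?_ ?_ ?_
    · intro j hj
      rw [Finset.mem_eraseNone, Finset.mem_image] at hj
      obtain ⟨u, -, hu⟩ := hj
      refine Finset.mem_erase.2 ⟨?_, Finset.mem_univ j⟩
      rintro rfl
      have := u.2
      rw [hu] at this
      exact hG this
    · rw [← Finset.card_map Function.Embedding.some, Finset.map_some_eraseNone]
      have h1 := Finset.card_erase_le (s := Tᶜ.image (Subtype.val (p := fun u => G.Adj u (some i))))
        (a := none)
      have h2 := Finset.card_image_le (s := Tᶜ) (f := Subtype.val (p := fun u => G.Adj u (some i)))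
      omega
    · rw [Finset.card_erase_of_mem (Finset.mem_univ i), Finset.card_univ, Fintype.card_fin]
      omega
  have hiK : i ∉ K := fun h => Finset.notMem_erase i _ (hKi h)
  obtain ⟨decode, hdec⟩ := hP.recovery (insert i K) (by
    rw [Finset.card_insert_of_notMem hiK]; omega)
  let W : A × Ω → (u : T) → Fin P.rounds → M :=
    fun x u => P.linkData u.1.1 (some i) u.1.2 x
  have hfac : (fun x => decode (P.jointView (insert i K) x)).FactorsThrough
      (fun x => (W x, P.jointView K x)) := by
    intro x y hxy
    have hW : W x = W y := congrArg Prod.fst hxy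
    have hK : ∀ j ∈ K, P.view j x = P.view j y := fun j hj =>
      congrFun (congrArg Prod.snd hxy) ⟨j, hj⟩
    have hi : P.view i x = P.view i y := by
      suffices h : ∀ u : InNbr G (some i),
          P.linkData u.1 (some i) u.2 x = P.linkData u.1 (some i) u.2 y from
        funext fun t => funext fun u => congrFun (h u) t
      intro u
      by_cases hu : u ∈ T
      · exact congrFun hW ⟨u, hu⟩
      · obtain ⟨v, hv⟩ := u
        cases v with
        | none => exact absurd rfl (hD _ hu)
        | some j =>
          refine P.linkData_eq_of_view_eq hv (hK j (hTK ?_))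
          rw [Finset.mem_eraseNone, Finset.mem_image]
          exact ⟨_, Finset.mem_compl.2 hu, rfl⟩
    refine congrArg decode (funext fun j => ?_)
    rcases Finset.mem_insert.1 j.2 with h | h
    · have : ∀ j, j = i → P.view j x = P.view j y := by rintro _ rfl; exact hi
      exact this _ h
    · exact hK _ h
  -- An element of `A` serves as the value of `F` off the range of the pair of data.
  obtain ⟨x₀⟩ : Nonempty (A × Ω) := (law.prod coins).nonempty_of_neZero
  have : Nonempty A := ⟨x₀.1⟩
  obtain ⟨F, hF⟩ := (Function.factorsThrough_iff _).1 hfac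
  have hWm : Measurable W := measurable_pi_lambda _ fun u => P.measurable_linkData _ _ _
  have hle := entropy_le_of_indepFun_of_determined (μ := law.prod coins) measurable_fst
    (P.measurable_jointView K) hWm (hP.secrecy K (by omega)) F (by
      filter_upwards [hdec] with x hx
      exact (congrFun hF x).symm.trans hx)
  have hfst : entropy (law.prod coins) (Prod.fst : A × Ω → A) = entropy law (id : A → A) := by
    refine Finset.sum_congr rfl fun a _ => ?_
    congr 1
    change (law.prod coins).real (Prod.fst ⁻¹' {a}) = law.real {a}
    rw [← Set.prod_univ, measureReal_prod_prod, probReal_univ, mul_one]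
  rw [← hfst]
  exact hle.trans (entropy_restrict_le_sum
    (fun u : InNbr G (some i) => P.linkData u.1 (some i) u.2)
    (fun u => P.measurable_linkData _ _ _) T)

end Protocol

end SecretSharing

/-! ### Summation over the participants -/

theorem mainTheorem5 {n k : ℕ} (hk : 1 < k) (hkn : k ≤ n)
    (G : Digraph (SecretSharing.Node n)) (hG : ∀ v, ¬ G.Adj v v)
    {A Ω M : Type*}
    [Fintype A] [MeasurableSpace A] [MeasurableSingletonClass A]
    [MeasurableSpace Ω]
    [Fintype M] [MeasurableSpace M] [MeasurableSingletonClass M]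
    (law : MeasureTheory.Measure A) [MeasureTheory.IsProbabilityMeasure law]
    (coins : MeasureTheory.Measure Ω) [MeasureTheory.IsProbabilityMeasure coins]
    (hlaw : 0 < SecretSharing.entropy law (id : A → A))
    (P : SecretSharing.Protocol G A Ω M)
    (hP : P.IsSecretSharing law coins k) :
    (∀ i, i ∉ SecretSharing.dealerNbrs G → k ≤ SecretSharing.inDegree G (some i)) ∧
    ((SecretSharing.dealerNbrs G).card : ℝ) +
        ∑ i ∈ (SecretSharing.dealerNbrs G)ᶜ,
          (SecretSharing.inDegree G (some i) : ℝ) /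
            ((SecretSharing.inDegree G (some i) : ℝ) - (k : ℝ) + 1)
      ≤ P.totalCommunication law coins ∧
    (n : ℝ) ≤ ((SecretSharing.dealerNbrs G).card : ℝ) +
        ∑ i ∈ (SecretSharing.dealerNbrs G)ᶜ,
          (SecretSharing.inDegree G (some i) : ℝ) /
            ((SecretSharing.inDegree G (some i) : ℝ) - (k : ℝ) + 1) := by
  classical
  have hnone : ∀ i, i ∉ SecretSharing.dealerNbrs G →
      ∀ u : SecretSharing.InNbr G (some i), u.1 ≠ none := by
    intro i hi u hu
    refine hi (Finset.mem_filter.2 ⟨Finset.mem_univ i, ?_⟩)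
    exact hu ▸ u.2
  have hcard : ∀ i : Fin n, Fintype.card (SecretSharing.InNbr G (some i)) =
      SecretSharing.inDegree G (some i) := by
    intro i
    rw [SecretSharing.inDegree, Fintype.card_subtype]
  have hdeg : ∀ i, i ∉ SecretSharing.dealerNbrs G → k ≤ SecretSharing.inDegree G (some i) := by
    intro i hi
    by_contra! hlt
    -- With fewer than `k` incoming links, `T = ∅` is admissible and would force the entropy of the
    -- secret to be at most zero.
    have := hP.entropy_le_sum_linkData (by omega) hkn i (hG _) ∅
      (by rwa [Finset.compl_empty, Finset.card_univ, hcard]) fun u _ => hnone i hi u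
    rw [Finset.sum_empty] at this
    exact this.not_gt hlaw
  refine ⟨hdeg, ?_, ?_⟩
  · have hdl : ∀ v, 0 ≤ P.download law coins v := fun v =>
      Finset.sum_nonneg fun u _ => SecretSharing.entropy_nonneg _
    have hnbr : ∀ i, SecretSharing.entropy law (id : A → A) ≤ P.download law coins (some i) := by
      intro i
      refine (hP.entropy_le_sum_linkData (by omega) hkn i (hG _) Finset.univ
        (by simpa using by omega) (by simp)).trans (le_of_eq ?_)
      rw [SecretSharing.Protocol.download]
    have hfar : ∀ i, i ∉ SecretSharing.dealerNbrs G →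
        (SecretSharing.inDegree G (some i) : ℝ) /
            ((SecretSharing.inDegree G (some i) : ℝ) - (k : ℝ) + 1) *
          SecretSharing.entropy law (id : A → A) ≤ P.download law coins (some i) := by
      intro i hi
      have hd := hdeg i hi
      -- This is the least size of `T` allowed: its complement has `k - 1` links.
      have h := SecretSharing.card_mul_le_mul_sum_of_card_eq
        (m := SecretSharing.inDegree G (some i) - k + 1) (Nat.succ_pos _)
        (fun T hT => hP.entropy_le_sum_linkData (by omega) hkn i (hG _) T
          (by rw [Finset.card_compl, hcard]; omega) fun u _ => hnone i hi u)
        (SecretSharing.inDegree G (some i)) (by omega) Finset.univ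
        (by rw [Finset.card_univ, hcard])
      rw [Nat.cast_add_one, Nat.cast_sub hd] at h
      have hpos : (0 : ℝ) < (SecretSharing.inDegree G (some i) : ℝ) - k + 1 := by
        have : (k : ℝ) ≤ SecretSharing.inDegree G (some i) := by exact_mod_cast hd
        linarith
      rw [div_mul_eq_mul_div, div_le_iff₀ hpos, mul_comm (P.download law coins (some i))]
      exact h
    -- Communication is grouped by receiver; what the dealer receives is only bounded below by zero.
    rw [SecretSharing.Protocol.totalCommunication, le_div_iff₀ hlaw, Fintype.sum_option, add_mul,
      Finset.sum_mul, ← Finset.sum_add_sum_compl (SecretSharing.dealerNbrs G)]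
    have h1 := Finset.sum_le_sum fun i (_ : i ∈ SecretSharing.dealerNbrs G) => hnbr i
    rw [Finset.sum_const, nsmul_eq_mul] at h1
    have h2 := Finset.sum_le_sum fun i (hi : i ∈ (SecretSharing.dealerNbrs G)ᶜ) =>
      hfar i (Finset.mem_compl.1 hi)
    have h3 := hdl none
    linarith
  · have h1 : ∑ i ∈ (SecretSharing.dealerNbrs G)ᶜ, (1 : ℝ) ≤
        ∑ i ∈ (SecretSharing.dealerNbrs G)ᶜ, (SecretSharing.inDegree G (some i) : ℝ) /
            ((SecretSharing.inDegree G (some i) : ℝ) - (k : ℝ) + 1) := by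
      refine Finset.sum_le_sum fun i hi => ?_
      have h2 : (k : ℝ) ≤ SecretSharing.inDegree G (some i) := by
        exact_mod_cast hdeg i (Finset.mem_compl.1 hi)
      have h3 : (1 : ℝ) < k := by exact_mod_cast hk
      rw [one_le_div (by linarith)]
      linarith
    have h2 : ((SecretSharing.dealerNbrs G).card : ℝ) + (SecretSharing.dealerNbrs G)ᶜ.card = n := by
      have := Finset.card_add_card_compl (SecretSharing.dealerNbrs G)
      rw [Fintype.card_fin] at this
      exact_mod_cast this
    rw [Finset.sum_const, nsmul_eq_mul, mul_one] at h1
    linarith
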